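/- Fix an integer $n\ge 2$. For $l\ge 1$ let $B_l$ be the set of words $(\nu_1\le\nu_2\le\cdots\le\nu_l)$ with letters in $\{1,\dots,n\}$, with the following operators $e_i,f_i:B_l\to B_l\sqcup\{0\}$ for $0\le i\le n-1$. For $1\le i\le n-1$, $e_i$ replaces one letter $i+1$ by $i$ and $f_i$ replaces one letter $i$ by $i+1$; $e_0$ replaces one letter $1$ by $n$ and $f_0$ replaces one letter $n$ by $1$ (words are re-sorted); the result is $0$ if there is no letter to be replaced. Put $\varepsilon_i(b)=\max\{m\ge0: e_i^mb\ne0\}$ and $\varphi_i(b)=\max\{m\ge 0: f_i^mb\neq0\}$. On $B_l\otimes B_{l'}=\{b\otimes b'\}$ let $e_i(b\otimes b')=e_ib\otimes b'$ if $\varphi_i(b)\ge\varepsilon_i(b')$ and $b\otimes e_ib'$ otherwise, and $f_i(b\otimes b')=f_ib\otimes b'$ if $\varphi_i(b)>\varepsilon_i(b')$ and $b\otimes f_ib'$ otherwise (where $b\otimes 0=0\otimes b'=0$). Let $$B_l\otimes B_1\simeq B_1\otimes B_l,\qquad b\otimes b'\mapsto\tilde b'\otimes\tilde b,$$ be the unique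 bijection commuting with all $e_i,f_i$, and let $H:B_l\otimes B_1\to\mathbf Z$ be the energy function, i.e. the unique function with $H((n^l)\otimes(n))=0$, where $(n^l)=(n,\dots,n)\in B_l$, such that whenever $e_i(b\otimes b')\ne0$, $$H(e_i(b\otimes b'))=\begin{cases}H(b\otimes b')+1&\text{if } i=0,\ \varphi_0(b)\ge\varepsilon_0(b'),\ \varphi_0(\tilde b')\ge\varepsilon_0(\tilde b),\\ H(b\otimes b')-1&\text{if } i=0,\ \varphi_0(b)<\varepsilon_0(b'),\ \varphi_0(\tilde b')<\varepsilon_0(\tilde b),\\ H(b\otimes b')&\text{otherwise.}\end{cases}$$ A state is an element $p=b_1\otimes b_2\otimes\cdots$ with $b_j\in B_1$ for all $j\geq 1$ and $b_j=(n)$ for all but finitely many $j$; thus every element of $B_1^{\otimes L}$ is regarded as a state by appending factors $(n)$. For $l\ge1$ and a state $p$ put $b^{(0)}=(n^l)$ and define $\tilde b_j\in B_1$ and $b^{(j)}\in B_l$ for $j=1,2,\dots$ by $b^{(j-1)}\otimes b_j\mapsto\tilde b_j\otimes b^{(j)}$ under the isomorphism above. Then $b^{(j)}=(n^l)$ for all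 large $j$, and one defines the time evolution $$T_l(p)=\tilde b_1\otimes\tilde b_2\otimes\cdots,$$ which is again a state, and the energy sum $$E_l(p)=-\sum_{j\ge1}H(b^{(j-1)}\otimes b_j),$$ which has only finitely many nonzero terms. For fixed $p$ the states $T_l(p)$ agree for all sufficiently large $l$; let $T(p)=\lim_{l\to\infty}T_l(p)$ be their common value. **Theorem.** For every state $p$ and all integers $l,l'\ge1$: 1. $T_lT_{l'}(p)=T_{l'}T_l(p)$; 2. $E_l(T_{l'}(p))=E_l(p)$; in particular, $E_l(T(p))=E_l(p)$. -/

import Mathlib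

set_option linter.unusedSectionVars false

namespace BoxBall

/-! ### The crystals `B_l`

The letters `1, …, n` are represented by `Fin n` in increasing order, so that the
letter `n` is `⊤ : Fin n`. The cyclic subtraction `i - 1` of `Fin n` takes the first letter
to the last one. -/

/-- The set `B_l` of weakly increasing words of length `l` in the `n` letters (semistandard
tableaux of one row of length `l`). Such a word is determined by the number `b.1 a` of
occurrences of each letter `a`. -/
abbrev B (n l : ℕ) : Type := {x : Fin n → ℕ // ∑ a, x a = l}

section crystal

variable {n : ℕ} [n.AtLeastTwo]

theorem B.ext {l : ℕ} {b c : B n l} (h : ∀ a, b.1 a = c.1 a) : b = c :=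
  Subtype.ext (funext h)

theorem pred_ne (i : Fin n) : i - 1 ≠ i := by
  intro h
  have : (1 : Fin n) = 0 := by simpa using h
  have h1 := congrArg Fin.val this
  have h2 : 2 ≤ n := Nat.AtLeastTwo.prop
  rw [Fin.val_one', Nat.mod_eq_of_lt (by omega)] at h1
  simp at h1

/-- `replaceLetter b u v h`: replace one letter `u` of the word `b` by the letter `v`. -/
def replaceLetter {l : ℕ} (b : B n l) (u v : Fin n) (h : 0 < b.1 u) : B n l :=
  ⟨b.1 - Pi.single u 1 + Pi.single v 1, by
    have hb := b.2
    have h1 : b.1 - Pi.single u 1 + Pi.single u 1 = b.1 := by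
      funext a
      by_cases ha : a = u
      · subst ha; simp; omega
      · simp [ha]
    have h2 : ∑ a, (b.1 - Pi.single u 1 : Fin n → ℕ) a + 1 = l := by
      have h3 := congrArg (fun g : Fin n → ℕ => ∑ a, g a) h1
      simp only [Pi.add_apply, Finset.sum_add_distrib, Finset.sum_pi_single', Finset.mem_univ,
        if_true] at h3
      exact h3.trans hb
    simpa [Finset.sum_add_distrib] using h2⟩

theorem replaceLetter_spec {l : ℕ} (b : B n l) (u v : Fin n) (h : 0 < b.1 u) (a : Fin n) :
    (replaceLetter b u v h).1 a + (if a = u then 1 else 0) = b.1 a + (if a = v then 1 else 0) := by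
  by_cases hu : a = u
  · subst hu
    simp only [replaceLetter, Pi.add_apply, Pi.sub_apply, Pi.single_apply]
    split_ifs <;> omega
  · simp only [replaceLetter, Pi.add_apply, Pi.sub_apply, Pi.single_apply]
    split_ifs <;> omega

/-- The operator `e_i`, with value `none` in place of `0`. For `i = 1, …, n - 1` a letter
`i + 1` is replaced by `i`; for `i = 0` a letter `1` is replaced by `n`. In `Fin n`
both cases read: a letter `i` is replaced by `i - 1`. -/
def e {l : ℕ} (i : Fin n) (b : B n l) : Option (B n l) :=
  if h : 0 < b.1 i then some (replaceLetter b i (i - 1) h) else none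

/-- The operator `f_i`, with value `none` in place of `0`. For `i = 1, …, n - 1` a letter
`i` is replaced by `i + 1`; for `i = 0` a letter `n` is replaced by `1`. In `Fin n`
both cases read: a letter `i - 1` is replaced by `i`. -/
def f {l : ℕ} (i : Fin n) (b : B n l) : Option (B n l) :=
  if h : 0 < b.1 (i - 1) then some (replaceLetter b (i - 1) i h) else none

/-- `ε_i(b) = max {m ≥ 0 | e_i^m b ≠ 0}`. -/
noncomputable def eps {l : ℕ} (i : Fin n) (b : B n l) : ℕ :=
  sSup {m : ℕ | (fun o : Option (B n l) => o.bind (e i))^[m] (some b) ≠ none}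

/-- `φ_i(b) = max {m ≥ 0 | f_i^m b ≠ 0}`. -/
noncomputable def phi {l : ℕ} (i : Fin n) (b : B n l) : ℕ :=
  sSup {m : ℕ | (fun o : Option (B n l) => o.bind (f i))^[m] (some b) ≠ none}

theorem e_some {l : ℕ} {i : Fin n} {b c : B n l} :
    e i b = some c ↔ 0 < b.1 i ∧ ∀ a, c.1 a + (if a = i then 1 else 0) =
      b.1 a + (if a = i - 1 then 1 else 0) := by
  unfold e
  split_ifs with h
  · simp only [Option.some.injEq, h, true_and]
    constructor
    · rintro rfl a; exact replaceLetter_spec ..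
    · intro hc
      refine B.ext fun a => ?_
      have := hc a
      have := replaceLetter_spec b i (i - 1) h a
      omega
  · simp [h]

theorem f_some {l : ℕ} {i : Fin n} {b c : B n l} :
    f i b = some c ↔ 0 < b.1 (i - 1) ∧ ∀ a, c.1 a + (if a = i - 1 then 1 else 0) =
      b.1 a + (if a = i then 1 else 0) := by
  unfold f
  split_ifs with h
  · simp only [Option.some.injEq, h, true_and]
    constructor
    · rintro rfl a; exact replaceLetter_spec ..
    · intro hc
      refine B.ext fun a => ?_
      have := hc a
      have := replaceLetter_spec b (i - 1) i h a
      omega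
  · simp [h]

theorem e_none {l : ℕ} {i : Fin n} {b : B n l} : e i b = none ↔ b.1 i = 0 := by
  unfold e; split_ifs with h <;> simp <;> omega

theorem f_none {l : ℕ} {i : Fin n} {b : B n l} : f i b = none ↔ b.1 (i - 1) = 0 := by
  unfold f; split_ifs with h <;> simp <;> omega

theorem bind_none_iterate {α : Type*} (g : α → Option α) (m : ℕ) :
    (fun o : Option α => o.bind g)^[m] none = none := by
  induction m with
  | zero => rfl
  | succ m ih => rw [Function.iterate_succ_apply]; exact ih

theorem sSup_iterate {α : Type*} (g : α → Option α) (c : α → ℕ)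
    (h0 : ∀ b, c b = 0 → g b = none)
    (h1 : ∀ b, 0 < c b → ∃ b', g b = some b' ∧ c b' + 1 = c b) (b : α) :
    sSup {m : ℕ | (fun o : Option α => o.bind g)^[m] (some b) ≠ none} = c b := by
  have key : ∀ (m : ℕ) (b : α),
      (fun o : Option α => o.bind g)^[m] (some b) ≠ none ↔ m ≤ c b := by
    intro m
    induction m with
    | zero => intro b; simp
    | succ m ih =>
      intro b
      rw [Function.iterate_succ_apply]
      simp only [Option.bind_some]
      rcases Nat.eq_zero_or_pos (c b) with h | h
      · rw [h0 b h, bind_none_iterate]; simp; omega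
      · obtain ⟨b', hb, hc⟩ := h1 b h
        rw [hb, ih b']; omega
  have : {m : ℕ | (fun o : Option α => o.bind g)^[m] (some b) ≠ none} = Set.Iic (c b) := by
    ext m; exact key m b
  rw [this, csSup_Iic]

/-- `ε_i(b)` is the number of letters `i + 1` in `b`. -/
theorem eps_eq {l : ℕ} (i : Fin n) (b : B n l) : eps i b = b.1 i := by
  refine sSup_iterate (e i) (fun b => b.1 i) (fun b h => e_none.2 h) (fun b h => ?_) b
  refine ⟨_, by unfold e; rw [dif_pos h], ?_⟩
  have := replaceLetter_spec b i (i - 1) h i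
  simpa [(pred_ne i).symm] using this

/-- `φ_i(b)` is the number of letters `i` (of letters `n` for `i = 0`) in `b`. -/
theorem phi_eq {l : ℕ} (i : Fin n) (b : B n l) : phi i b = b.1 (i - 1) := by
  refine sSup_iterate (f i) (fun b => b.1 (i - 1)) (fun b h => f_none.2 h) (fun b h => ?_) b
  refine ⟨_, by unfold f; rw [dif_pos h], ?_⟩
  have := replaceLetter_spec b (i - 1) i h (i - 1)
  simpa [pred_ne i] using this

theorem f_of_e {l : ℕ} {i : Fin n} {b c : B n l} (h : e i b = some c) : f i c = some b := by
  rw [e_some] at h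
  rw [f_some]
  refine ⟨?_, fun a => (h.2 a).symm⟩
  have := h.2 (i - 1)
  simp [pred_ne i] at this
  omega

theorem e_of_f {l : ℕ} {i : Fin n} {b c : B n l} (h : f i b = some c) : e i c = some b := by
  rw [f_some] at h
  rw [e_some]
  refine ⟨?_, fun a => (h.2 a).symm⟩
  have := h.2 i
  simp [(pred_ne i).symm] at this
  omega

/-- The word `(a^l) = (a, a, …, a)` in `B_l`. -/
def const (l : ℕ) (a : Fin n) : B n l := ⟨Pi.single a l, by simp⟩

theorem const_apply (l : ℕ) (a k : Fin n) : (const l a).1 k = if k = a then l else 0 := by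
  simp [const, Pi.single_apply]

/-! ### Tensor products, the isomorphism and the energy function -/

/-- The operator `e_i` on `B_l ⊗ B_{l'}`. -/
noncomputable def tensorE {l l' : ℕ} (i : Fin n) (p : B n l × B n l') :
    Option (B n l × B n l') :=
  if phi i p.1 ≥ eps i p.2 then (e i p.1).map (fun c => (c, p.2))
  else (e i p.2).map (fun c => (p.1, c))

/-- The operator `f_i` on `B_l ⊗ B_{l'}`. -/
noncomputable def tensorF {l l' : ℕ} (i : Fin n) (p : B n l × B n l') :
    Option (B n l × B n l') :=
  if phi i p.1 > eps i p.2 then (f i p.1).map (fun c => (c, p.2))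
  else (f i p.2).map (fun c => (p.1, c))

/-- `σ : B_l ⊗ B_{l'} → B_{l'} ⊗ B_l` is an isomorphism of crystals: a bijection that commutes
with all operators `e_i` and `f_i` (and takes `0` to `0`). -/
def IsCrystalIso {l l' : ℕ} (σ : B n l × B n l' ≃ B n l' × B n l) : Prop :=
  ∀ i p, tensorE i (σ p) = (tensorE i p).map σ ∧ tensorF i (σ p) = (tensorF i p).map σ

/-- `H : B_l ⊗ B_{l'} → ℤ` is the energy function, where `σ` is the isomorphism
`b ⊗ b' ↦ b̃' ⊗ b̃`, normalized by `H((n^l) ⊗ (n^{l'})) = 0`. -/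
def IsEnergyFunction {l l' : ℕ} (σ : B n l × B n l' ≃ B n l' × B n l)
    (H : B n l × B n l' → ℤ) : Prop :=
  H (const l ⊤, const l' ⊤) = 0 ∧
  ∀ i p q, tensorE i p = some q →
    H q =
      if i = 0 ∧ phi 0 p.1 ≥ eps 0 p.2 ∧ phi 0 (σ p).1 ≥ eps 0 (σ p).2 then H p + 1
      else if i = 0 ∧ phi 0 p.1 < eps 0 p.2 ∧ phi 0 (σ p).1 < eps 0 (σ p).2 then H p - 1
      else H p

theorem tensorE_some {l l' : ℕ} {i : Fin n} {p q : B n l × B n l'} :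
    tensorE i p = some q ↔
      (p.2.1 i ≤ p.1.1 (i - 1) ∧ e i p.1 = some q.1 ∧ p.2 = q.2) ∨
      (p.1.1 (i - 1) < p.2.1 i ∧ e i p.2 = some q.2 ∧ p.1 = q.1) := by
  unfold tensorE
  rw [phi_eq, eps_eq]
  obtain ⟨q1, q2⟩ := q
  split_ifs with h
  · have : ¬ p.1.1 (i - 1) < p.2.1 i := by omega
    simp only [Option.map_eq_some_iff, Prod.mk.injEq, h, true_and, this, false_and, or_false]
    grind
  · have h' : p.1.1 (i - 1) < p.2.1 i := by omega
    simp only [Option.map_eq_some_iff, Prod.mk.injEq, h', true_and]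
    have : ¬ p.2.1 i ≤ p.1.1 (i - 1) := by omega
    simp only [this, false_and, false_or]
    grind

theorem tensorF_some {l l' : ℕ} {i : Fin n} {p q : B n l × B n l'} :
    tensorF i p = some q ↔
      (p.2.1 i < p.1.1 (i - 1) ∧ f i p.1 = some q.1 ∧ p.2 = q.2) ∨
      (p.1.1 (i - 1) ≤ p.2.1 i ∧ f i p.2 = some q.2 ∧ p.1 = q.1) := by
  unfold tensorF
  rw [phi_eq, eps_eq]
  obtain ⟨q1, q2⟩ := q
  split_ifs with h
  · have : ¬ p.1.1 (i - 1) ≤ p.2.1 i := by omega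
    simp only [gt_iff_lt] at h
    simp only [Option.map_eq_some_iff, Prod.mk.injEq, h, true_and, this, false_and, or_false]
    grind
  · have h' : p.1.1 (i - 1) ≤ p.2.1 i := by omega
    simp only [Option.map_eq_some_iff, Prod.mk.injEq, h', true_and]
    have : ¬ p.2.1 i < p.1.1 (i - 1) := by omega
    simp only [this, false_and, false_or]
    grind

theorem tensorF_iff_tensorE {l l' : ℕ} {i : Fin n} {p q : B n l × B n l'} :
    tensorF i q = some p ↔ tensorE i p = some q := by
  obtain ⟨p1, p2⟩ := p
  obtain ⟨q1, q2⟩ := q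
  rw [tensorE_some, tensorF_some]
  have hne := pred_ne i
  constructor
  · rintro (⟨h, h1, h2⟩ | ⟨h, h1, h2⟩)
    · left
      refine ⟨?_, e_of_f h1, h2.symm⟩
      have := (f_some.1 h1).2 (i - 1)
      simp [hne] at this h h2 ⊢
      subst h2; omega
    · right
      refine ⟨?_, e_of_f h1, h2.symm⟩
      have := (f_some.1 h1).2 i
      simp [hne.symm] at this h h2 ⊢
      subst h2; omega
  · rintro (⟨h, h1, h2⟩ | ⟨h, h1, h2⟩)
    · left
      refine ⟨?_, f_of_e h1, h2.symm⟩
      have := (e_some.1 h1).2 (i - 1)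
      simp [hne] at this h h2 ⊢
      subst h2; omega
    · right
      refine ⟨?_, f_of_e h1, h2.symm⟩
      have := (e_some.1 h1).2 i
      simp [hne.symm] at this h h2 ⊢
      subst h2; omega

theorem tensorE_none {l l' : ℕ} {i : Fin n} {p : B n l × B n l'} :
    tensorE i p = none ↔ p.1.1 i = 0 ∧ p.2.1 i ≤ p.1.1 (i - 1) := by
  unfold tensorE
  rw [phi_eq, eps_eq]
  split_ifs with h <;> simp [e_none] <;> omega

theorem tensorF_none {l l' : ℕ} {i : Fin n} {p : B n l × B n l'} :
    tensorF i p = none ↔ p.2.1 (i - 1) = 0 ∧ p.1.1 (i - 1) ≤ p.2.1 i := by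
  unfold tensorF
  rw [phi_eq, eps_eq]
  split_ifs with h <;> simp [f_none] <;> omega

/-! ### Existence and uniqueness on `B_l ⊗ B_1` -/

/-- The letter `a` lies strictly between `j` and `i` in the cyclic order, when one goes up
from `j` to `i` (once around if `j = i`). -/
def Btw (j a i : Fin n) : Prop :=
  (j.val < a.val ∧ a.val < i.val) ∨ (i.val ≤ j.val ∧ (a.val < i.val ∨ j.val < a.val))

/-- `x ⊗ i` and `j ⊗ z` have the same content, and no letter of `x` lies cyclically
strictly between `j` and `i`. -/
def Rel {l : ℕ} (x : B n l) (i j : Fin n) (z : B n l) : Prop :=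
  (∀ a, x.1 a + (if a = i then 1 else 0) = z.1 a + (if a = j then 1 else 0)) ∧
  ∀ a, Btw j a i → x.1 a = 0

theorem val_pred (i : Fin n) : (i - 1).val = if i.val = 0 then n - 1 else i.val - 1 := by
  have h2 : 2 ≤ n := Nat.AtLeastTwo.prop
  have hi := i.2
  rw [Fin.val_sub, Fin.val_one', Nat.mod_eq_of_lt (by omega : 1 < n)]
  split_ifs with h
  · rw [h, Nat.mod_eq_of_lt (by omega)]; omega
  · rw [show n - 1 + i.val = (i.val - 1) + n by omega, Nat.add_mod_right,
      Nat.mod_eq_of_lt (by omega)]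

theorem val_sub_pred (i a : Fin n) :
    (i - 1 - a).val = if a.val < i.val then i.val - 1 - a.val else i.val + n - 1 - a.val := by
  have h2 : 2 ≤ n := Nat.AtLeastTwo.prop
  have hi := i.2
  have ha := a.2
  rw [Fin.val_sub, val_pred]
  by_cases h : a.val < i.val
  · rw [if_pos h, if_neg (by omega), show n - a.val + (i.val - 1) = (i.val - 1 - a.val) + n by omega,
      Nat.add_mod_right, Nat.mod_eq_of_lt (by omega)]
  · rw [if_neg h]
    by_cases h0 : i.val = 0
    · rw [if_pos h0, show n - a.val + (n - 1) = (n - 1 - a.val) + n by omega,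
        Nat.add_mod_right, Nat.mod_eq_of_lt (by omega)]
      omega
    · rw [if_neg h0, Nat.mod_eq_of_lt (by omega)]
      omega

theorem ne_val {a b : Fin n} (h : a ≠ b) : a.val ≠ b.val := fun h' => h (Fin.ext h')

theorem rel_exists {l : ℕ} (x : B n l) (i : Fin n) : ∃ j z, Rel x i j z := by
  classical
  have hne : (Finset.univ.filter fun a : Fin n => 0 < x.1 a ∨ a = i).Nonempty := ⟨i, by simp⟩
  obtain ⟨j, hj, hmin⟩ := Finset.exists_min_image _ (fun a : Fin n => (i - 1 - a).val) hne
  have hmin' : ∀ a, Btw j a i → x.1 a = 0 := by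
    intro a ha
    by_contra hcon
    have := hmin a (by
      simp only [Finset.mem_filter, Finset.mem_univ, true_and]
      left; omega)
    rw [val_sub_pred, val_sub_pred] at this
    have hi := i.2
    have hj := j.2
    have ha' := a.2
    unfold Btw at ha
    split_ifs at this <;> omega
  simp only [Finset.mem_filter, Finset.mem_univ, true_and] at hj
  by_cases hji : j = i
  · subst hji
    exact ⟨j, x, fun a => rfl, hmin'⟩
  · have hx : 0 < x.1 j := by tauto
    exact ⟨j, replaceLetter x j i hx, fun a => (replaceLetter_spec x j i hx a).symm, hmin'⟩

theorem rel_exists' {l : ℕ} (j : Fin n) (z : B n l) : ∃ x i, Rel x i j z := by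
  classical
  have hne : (Finset.univ.filter fun a : Fin n => 0 < z.1 a ∨ a = j).Nonempty := ⟨j, by simp⟩
  obtain ⟨i, hi, hmin⟩ := Finset.exists_min_image _ (fun a : Fin n => (a - 1 - j).val) hne
  have hmin' : ∀ a, Btw j a i → z.1 a = 0 := by
    intro a ha
    by_contra hcon
    have := hmin a (by
      simp only [Finset.mem_filter, Finset.mem_univ, true_and]
      left; omega)
    rw [val_sub_pred, val_sub_pred] at this
    have hi := i.2
    have hj := j.2
    have ha' := a.2
    unfold Btw at ha
    split_ifs at this <;> omega
  simp only [Finset.mem_filter, Finset.mem_univ, true_and] at hi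
  by_cases hji : i = j
  · subst hji
    exact ⟨z, i, fun a => rfl, hmin'⟩
  · have hx : 0 < z.1 i := by tauto
    refine ⟨replaceLetter z i j hx, i, fun a => replaceLetter_spec z i j hx a, fun a ha => ?_⟩
    have h1 := replaceLetter_spec z i j hx a
    have h2 := hmin' a ha
    have haj : a ≠ j := by rintro rfl; unfold Btw at ha; omega
    simp [haj] at h1
    omega

theorem rel_unique {l : ℕ} {x : B n l} {i j j' : Fin n} {z z' : B n l}
    (h : Rel x i j z) (h' : Rel x i j' z') : j = j' ∧ z = z' := by
  have hj : j = j' := by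
    by_contra hne
    have hv := ne_val hne
    have h1 := h.2 j'
    have h2 := h'.2 j
    have h3 := h.1 j
    have h4 := h'.1 j'
    simp only [if_true] at h3 h4
    unfold Btw at h1 h2
    simp only [Fin.ext_iff] at h3 h4
    split_ifs at h3 h4 <;> omega
  subst hj
  refine ⟨rfl, B.ext fun a => ?_⟩
  have := h.1 a
  have := h'.1 a
  omega

theorem rel_unique' {l : ℕ} {x x' : B n l} {i i' j : Fin n} {z : B n l}
    (h : Rel x i j z) (h' : Rel x' i' j z) : x = x' ∧ i = i' := by
  have hj : i = i' := by
    by_contra hne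
    have hv := ne_val hne
    have h1 := h.2 i'
    have h2 := h'.2 i
    have h3 := h.1 i
    have h4 := h'.1 i'
    have h5 := h.1 i'
    have h6 := h'.1 i
    unfold Btw at h1 h2
    simp only [Fin.ext_iff] at h3 h4 h5 h6
    split_ifs at h3 h4 h5 h6 <;> omega
  subst hj
  refine ⟨B.ext fun a => ?_, rfl⟩
  have := h.1 a
  have := h'.1 a
  omega

theorem letter_unique {i j : Fin n} (h : const 1 i = const 1 j) : i = j := by
  have := congrArg (fun b : B n 1 => b.1 i) h
  simp only [const_apply] at this
  by_contra hne
  simp [hne] at this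

theorem letter_exists (b : B n 1) : ∃ i, b = const 1 i := by
  have h : ∃ i, 0 < b.1 i := by
    by_contra hcon
    have h0 : ∀ i, b.1 i = 0 := fun i => by
      by_contra h
      exact hcon ⟨i, by omega⟩
    have := b.2
    simp [h0] at this
  obtain ⟨i, hi⟩ := h
  have hs := b.2
  rw [← Finset.add_sum_erase _ _ (Finset.mem_univ i)] at hs
  refine ⟨i, B.ext fun a => ?_⟩
  rw [const_apply]
  split_ifs with ha
  · subst ha; omega
  · have := Finset.single_le_sum (f := b.1) (fun _ _ => Nat.zero_le _)
      (Finset.mem_erase.2 ⟨ha, Finset.mem_univ a⟩)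
    omega

theorem e_letter {k i i' : Fin n} :
    e k (const 1 i) = some (const 1 i') ↔ i = k ∧ i' = k - 1 := by
  rw [e_some]
  simp only [const_apply]
  have hne := pred_ne k
  constructor
  · rintro ⟨h1, h2⟩
    have hk : k = i := by by_contra h; simp [h] at h1
    subst hk
    refine ⟨rfl, ?_⟩
    have := h2 (k - 1)
    by_contra h
    simp [hne, Ne.symm h] at this
  · rintro ⟨rfl, rfl⟩
    refine ⟨by simp, fun a => ?_⟩
    omega

theorem stepXI {l : ℕ} {x x' : B n l} {k i i' : Fin n} :
    tensorE k (x, const 1 i) = some (x', const 1 i') ↔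
      (i = i' ∧ (if k = i then 1 else 0) ≤ x.1 (k - 1) ∧ 0 < x.1 k ∧
        ∀ a, x'.1 a + (if a = k then 1 else 0) = x.1 a + (if a = k - 1 then 1 else 0)) ∨
      (x.1 (k - 1) = 0 ∧ i = k ∧ i' = k - 1 ∧ x = x') := by
  rw [tensorE_some]
  simp only [e_letter]
  simp only [const_apply, e_some]
  constructor
  · rintro (⟨h1, h2, h3⟩ | ⟨h1, h2, h3⟩)
    · exact Or.inl ⟨letter_unique h3, h1, h2⟩
    · right
      simp [h2.1] at h1
      exact ⟨h1, h2.1, h2.2, h3⟩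
  · rintro (⟨h1, h2, h3⟩ | ⟨h1, h2, h3, h4⟩)
    · exact Or.inl ⟨h2, h3, by rw [h1]⟩
    · right
      subst h2 h3 h4
      simp [h1]

theorem stepJZ {l : ℕ} {z z' : B n l} {k j j' : Fin n} :
    tensorE k (const 1 j, z) = some (const 1 j', z') ↔
      (z.1 k = 0 ∧ j = k ∧ j' = k - 1 ∧ z = z') ∨
      (j = j' ∧ (if k - 1 = j then 1 else 0) < z.1 k ∧
        ∀ a, z'.1 a + (if a = k then 1 else 0) = z.1 a + (if a = k - 1 then 1 else 0)) := by
  rw [tensorE_some]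
  simp only [e_letter]
  simp only [const_apply, e_some]
  constructor
  · rintro (⟨h1, h2, h3⟩ | ⟨h1, h2, h3⟩)
    · left
      rw [h2.1, if_neg (pred_ne k)] at h1
      replace h1 := Nat.le_zero.1 h1
      exact ⟨h1, h2.1, h2.2, h3⟩
    · exact Or.inr ⟨letter_unique h3, h1, h2.2⟩
  · rintro (⟨h1, h2, h3, h4⟩ | ⟨h1, h2, h3⟩)
    · left
      subst h2 h3 h4
      simp [h1]
    · exact Or.inr ⟨h2, ⟨by omega, h3⟩, by rw [h1]⟩

theorem rel_step {l : ℕ} {x z : B n l} {i j : Fin n} (h : Rel x i j z) (k : Fin n)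
    {x' : B n l} {i' : Fin n}
    (hs : tensorE k (x, const 1 i) = some (x', const 1 i')) :
    ∃ j' z', tensorE k (const 1 j, z) = some (const 1 j', z') ∧ Rel x' i' j' z' := by
  have hkp := val_pred k
  have hne := pred_ne k
  rw [stepXI] at hs
  simp only [stepJZ]
  generalize k - 1 = m at *
  obtain ⟨hc, ha⟩ := h
  have hk2 := k.2
  have hi2 := i.2
  have hj2 := j.2
  have hv := ne_val hne
  by_cases hL : j = k ∧ z.1 k = 0
  · obtain ⟨rfl, hz⟩ := hL
    have hcj := hc j
    have hcm := hc m
    refine ⟨m, z, Or.inl ⟨hz, rfl, rfl, rfl⟩, ?_, ?_⟩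
    · intro a
      have hca := hc a
      rcases hs with ⟨rfl, h1, h2, h3⟩ | ⟨h1, rfl, rfl, rfl⟩
      · have h3a := h3 a
        omega
      · omega
    · intro a hb
      have hca := hc a
      have haa := ha a
      have hva := a.2
      rcases hs with ⟨rfl, h1, h2, h3⟩ | ⟨h1, rfl, rfl, rfl⟩
      · have h3a := h3 a
        have hij : i ≠ j := by rintro rfl; simp at hcj; omega
        have hvij := ne_val hij
        by_cases haj : a = j
        · subst haj
          simp [hij.symm, hne.symm] at hcj h3a
          omega
        · by_cases ham : a = m
          · subst ham; unfold Btw at hb; omega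
          · have hvm := ne_val ham
            have hvj := ne_val haj
            simp [haj, ham] at h3a
            rw [h3a]
            apply haa
            unfold Btw at hb ⊢
            split_ifs at hkp <;> omega
      · by_cases hai : a = i
        · subst hai; simp at hcj; omega
        · have hvi := ne_val hai
          apply haa
          unfold Btw
          omega
  · have hck := hc k
    have hcm := hc m
    have hak := ha k
    have ham := ha m
    have hz : (if m = j then 1 else 0) < z.1 k := by
      by_cases hmj : m = j
      · subst hmj
        simp only [if_true, hne.symm, if_false] at hcm hck ⊢
        rcases hs with ⟨rfl, h1, h2, h3⟩ | ⟨h1, rfl, rfl, rfl⟩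
        · by_cases hki : k = i
          · simp [hki] at hck h2 ⊢; omega
          · have hvki := ne_val hki
            have : Btw m k i := by
              unfold Btw
              split_ifs at hkp <;> omega
            have := hak this
            omega
        · rw [if_neg hne] at hcm; omega
      · rw [if_neg hmj]
        by_cases hkj : k = j
        · subst hkj; simp at hL; omega
        · rw [if_neg hkj] at hck
          rcases hs with ⟨rfl, h1, h2, h3⟩ | ⟨h1, rfl, rfl, rfl⟩
          · omega
          · simp at hck; omega
    have hz0 : 0 < z.1 k := by omega
    refine ⟨j, replaceLetter z k m hz0, Or.inr ⟨rfl, hz, replaceLetter_spec z k m hz0⟩, ?_, ?_⟩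
    · intro a
      have hca := hc a
      have hra := replaceLetter_spec z k m hz0 a
      rcases hs with ⟨rfl, h1, h2, h3⟩ | ⟨h1, rfl, rfl, rfl⟩
      · have h3a := h3 a
        omega
      · omega
    · intro a hb
      have haa := ha a
      have hva := a.2
      rcases hs with ⟨rfl, h1, h2, h3⟩ | ⟨h1, rfl, rfl, rfl⟩
      · have h3a := h3 a
        have hxa := haa hb
        by_cases h4 : a = k
        · subst h4; omega
        · by_cases h5 : a = m
          · subst h5
            exfalso
            by_cases hki : k = i
            · simp [hki] at h1; omega
            · have hvki := ne_val hki
              have : Btw j k i := by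
                unfold Btw at hb ⊢
                by_cases hkj : k = j
                · subst hkj
                  split_ifs at hkp <;> omega
                · have := ne_val hkj
                  split_ifs at hkp <;> omega
              have := hak this
              omega
          · simp [h4, h5] at h3a; omega
      · have hmj : i' ≠ j := by rintro rfl; rw [if_neg hne, if_pos rfl] at hcm; omega
        have hvmj := ne_val hmj
        apply haa
        unfold Btw at hb ⊢
        split_ifs at hkp <;> omega

theorem rel_none {l : ℕ} {x z : B n l} {i j : Fin n} (h : Rel x i j z) (k : Fin n)
    (hs : tensorE k (x, const 1 i) = none) : tensorE k (const 1 j, z) = none := by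
  have hkp := val_pred k
  have hne := pred_ne k
  rw [tensorE_none] at hs ⊢
  simp only [const_apply] at hs ⊢
  generalize k - 1 = m at *
  obtain ⟨hc, ha⟩ := h
  have hck := hc k
  have hcm := hc m
  have hcj := hc j
  have hak := ha k
  have ham := ha m
  have hk2 := k.2
  have hi2 := i.2
  have hj2 := j.2
  have hv := ne_val hne
  obtain ⟨hx, hs⟩ := hs
  by_cases hki : k = i
  · subst hki
    simp only [if_true, hne, if_false] at *
    have hmj : m = j := by
      by_contra hmj
      have hvmj := ne_val hmj
      have : Btw j m k := by
        unfold Btw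
        split_ifs at hkp <;> omega
      have := ham this
      omega
    rw [if_neg (hmj ▸ hne.symm)] at hck ⊢
    rw [if_pos hmj]
    omega
  · simp only [hki, if_false] at *
    have h1 : k ≠ j := by rintro rfl; simp [hx] at hck
    simp only [h1, if_false] at *
    exact ⟨trivial, by omega⟩

/-- Unwinding pairs are those with `j < i`. -/
theorem rel_energy {l : ℕ} {x z x' z' : B n l} {i j i' j' : Fin n} (h : Rel x i j z) (k : Fin n)
    (hs : tensorE k (x, const 1 i) = some (x', const 1 i'))
    (hs' : tensorE k (const 1 j, z) = some (const 1 j', z')) :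
    (if j' < i' then -1 else 0 : ℤ) =
      if k = 0 ∧ (const 1 i).1 0 ≤ x.1 (0 - 1) ∧ z.1 0 ≤ (const 1 j).1 (0 - 1) then
        (if j < i then -1 else 0) + 1
      else if k = 0 ∧ x.1 (0 - 1) < (const 1 i).1 0 ∧ (const 1 j).1 (0 - 1) < z.1 0 then
        (if j < i then -1 else 0) - 1
      else (if j < i then -1 else 0) := by
  have hkp := val_pred k
  have hne := pred_ne k
  rw [stepXI] at hs
  rw [stepJZ] at hs'
  obtain ⟨hc, ha⟩ := h
  have hcm := hc (k - 1)
  have hck := hc k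
  have ham := ha (k - 1)
  have hi2 := i.2
  have hj2 := j.2
  have hk2 := k.2
  have hv := ne_val hne
  have hmj : x.1 (k - 1) = 0 → i = k → j ≠ k - 1 := by
    rintro h1 rfl rfl
    simp [hne, h1] at hcm
  have hik : (if k = i then 1 else 0) ≤ x.1 (k - 1) → 0 < x.1 k → ¬ (j = k ∧ i = k) := by
    rintro h1 h2 ⟨hjk, hik⟩
    rw [if_pos hik.symm] at h1
    have hjk' := congrArg Fin.val hjk
    have hik' := congrArg Fin.val hik
    have : Btw j (k - 1) i := by
      unfold Btw
      split_ifs at hkp <;> omega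
    have := ham this
    omega
  simp only [const_apply, Fin.lt_def]
  by_cases hk : k = 0
  · subst hk
    have h0 : (0 : Fin n).val = 0 := rfl
    simp only [true_and]
    rw [if_pos h0] at hkp
    have hi0 : 0 = i → (if 0 = i then 1 else 0) = 1 := fun h => if_pos h
    generalize (if (0 : Fin n) = i then 1 else 0) = A at *
    generalize (if (0 : Fin n) - 1 = j then 1 else 0) = C at *
    generalize (0 : Fin n) - 1 = m at *
    rcases hs with ⟨h1, h2, h3, h4⟩ | ⟨h1, h2, h3, h4⟩
    · have e1 := congrArg Fin.val h1
      rcases hs' with ⟨g1, g2, g3, g4⟩ | ⟨g1, g2, g3⟩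
      · have e2 := congrArg Fin.val g2
        have e3 := congrArg Fin.val g3
        have hi0 : i ≠ 0 := fun h => hik h2 h3 ⟨g2, h⟩
        have := ne_val hi0
        split_ifs <;> omega
      · subst g1 h1; split_ifs <;> omega
    · have hmj' := ne_val (hmj h1 h2)
      have e2 := congrArg Fin.val h2
      have e3 := congrArg Fin.val h3
      have hA := hi0 h2.symm
      rcases hs' with ⟨g1, g2, g3, g4⟩ | ⟨g1, g2, g3⟩
      · have e4 := congrArg Fin.val g2
        have e5 := congrArg Fin.val g3
        split_ifs <;> omega
      · have e4 := congrArg Fin.val g1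
        split_ifs <;> omega
  · have hv0 : k.val ≠ 0 := fun h => hk (Fin.ext h)
    simp only [hk, false_and, if_false]
    rw [if_neg hv0] at hkp
    generalize k - 1 = m at *
    rcases hs with ⟨h1, h2, h3, h4⟩ | ⟨h1, h2, h3, h4⟩
    · have e1 := congrArg Fin.val h1
      rcases hs' with ⟨g1, g2, g3, g4⟩ | ⟨g1, g2, g3⟩
      · have e2 := congrArg Fin.val g2
        have e3 := congrArg Fin.val g3
        have hi0 : i ≠ k := fun h => hik h2 h3 ⟨g2, h⟩
        have := ne_val hi0
        split_ifs <;> omega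
      · rw [g1, h1]
    · have hmj' := ne_val (hmj h1 h2)
      have e2 := congrArg Fin.val h2
      have e3 := congrArg Fin.val h3
      rcases hs' with ⟨g1, g2, g3, g4⟩ | ⟨g1, g2, g3⟩
      · have e4 := congrArg Fin.val g2
        have e5 := congrArg Fin.val g3
        split_ifs <;> omega
      · have e4 := congrArg Fin.val g1
        split_ifs <;> omega

/-- The relation between `b ⊗ b'` and `b̃' ⊗ b̃` given by the explicit rule. -/
def RelPair {l : ℕ} (p : B n l × B n 1) (q : B n 1 × B n l) : Prop :=
  ∃ i j, p.2 = const 1 i ∧ q.1 = const 1 j ∧ Rel p.1 i j q.2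

theorem exists_equiv (n l : ℕ) [n.AtLeastTwo] :
    ∃ σ : B n l × B n 1 ≃ B n 1 × B n l, ∀ p, RelPair p (σ p) := by
  have h1 : ∀ p : B n l × B n 1, ∃ q, RelPair p q := by
    rintro ⟨x, b⟩
    obtain ⟨i, rfl⟩ := letter_exists b
    obtain ⟨j, z, h⟩ := rel_exists x i
    exact ⟨(const 1 j, z), i, j, rfl, rfl, h⟩
  have h2 : ∀ q : B n 1 × B n l, ∃ p, RelPair p q := by
    rintro ⟨b, z⟩
    obtain ⟨j, rfl⟩ := letter_exists b
    obtain ⟨x, i, h⟩ := rel_exists' j z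
    exact ⟨(x, const 1 i), i, j, rfl, rfl, h⟩
  have u1 : ∀ {p : B n l × B n 1} {q q'}, RelPair p q → RelPair p q' → q = q' := by
    rintro ⟨x, b⟩ ⟨c, z⟩ ⟨c', z'⟩ ⟨i, j, rfl, rfl, h⟩ ⟨i', j', hi, rfl, h'⟩
    obtain rfl := letter_unique hi
    obtain ⟨rfl, rfl⟩ := rel_unique h h'
    rfl
  have u2 : ∀ {p p' : B n l × B n 1} {q}, RelPair p q → RelPair p' q → p = p' := by
    rintro ⟨x, b⟩ ⟨x', b'⟩ ⟨c, z⟩ ⟨i, j, rfl, rfl, h⟩ ⟨i', j', rfl, hj, h'⟩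
    obtain rfl := letter_unique hj
    obtain ⟨rfl, rfl⟩ := rel_unique' h h'
    rfl
  choose g hg using h1
  choose g' hg' using h2
  exact ⟨⟨g, g', fun p => u2 (hg' _) (hg p), fun q => u1 (hg _) (hg' q)⟩, hg⟩

theorem isCrystalIso_of_rel {l : ℕ} (σ : B n l × B n 1 ≃ B n 1 × B n l)
    (hσ : ∀ p, RelPair p (σ p)) : IsCrystalIso σ := by
  have hE : ∀ i p, tensorE i (σ p) = (tensorE i p).map σ := by
    intro k p
    obtain ⟨i, j, h1, h2, h⟩ := hσ p
    have hp : p = (p.1, const 1 i) := by rw [← h1]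
    have hq : σ p = (const 1 j, (σ p).2) := by rw [← h2]
    rcases hs : tensorE k p with _ | p'
    · rw [hq, rel_none h k (by rw [← hp]; exact hs)]
      rfl
    · obtain ⟨i', j', h1', h2', h'⟩ := hσ p'
      have hp' : p' = (p'.1, const 1 i') := by rw [← h1']
      have hq' : σ p' = (const 1 j', (σ p').2) := by rw [← h2']
      rw [hp, hp'] at hs
      obtain ⟨j'', z'', hs', h''⟩ := rel_step h k hs
      obtain ⟨rfl, hz⟩ := rel_unique h' h''
      rw [hq, hs', Option.map_some, hq', hz]
  refine fun i p => ⟨hE i p, ?_⟩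
  rcases hs : tensorF i p with _ | q
  · rw [Option.map_none]
    by_contra hne
    obtain ⟨r, hr⟩ := Option.ne_none_iff_exists'.1 hne
    have h1 := tensorF_iff_tensorE.1 hr
    have h2 := hE i (σ.symm r)
    rw [σ.apply_symm_apply, h1] at h2
    obtain ⟨q, hq, hq'⟩ := Option.map_eq_some_iff.1 h2.symm
    rw [σ.injective hq', ← tensorF_iff_tensorE, hs] at hq
    simp at hq
  · rw [tensorF_iff_tensorE] at hs
    rw [Option.map_some, tensorF_iff_tensorE, hE, hs, Option.map_some]

/-- Every element is taken to `(n^l) ⊗ (n)` by a sequence of operators `e_i`. -/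
theorem connected {l : ℕ} (P : B n l × B n 1 → Prop) (h0 : P (const l ⊤, const 1 ⊤))
    (hP : ∀ k p q, tensorE k p = some q → P q → P p) (p : B n l × B n 1) : P p := by
  have hA : ∀ i : Fin n, P (const l i, const 1 i) → ∀ (N : ℕ) (x : B n l),
      ∑ a, x.1 a * (a - i).val ≤ N → P (x, const 1 i) := by
    intro i hi N
    induction N with
    | zero =>
      intro x hx
      have hz : ∀ a, a ≠ i → x.1 a = 0 := by
        intro a ha
        have h1 := Finset.sum_eq_zero_iff.1 (Nat.le_zero.1 hx) a (Finset.mem_univ a)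
        rcases Nat.mul_eq_zero.1 h1 with h | h
        · exact h
        · exact absurd (sub_eq_zero.1 (Fin.ext (h.trans rfl))) ha
      have hxi : x = const l i := by
        refine B.ext fun a => ?_
        rw [const_apply]
        split_ifs with ha
        · subst ha
          exact ((Finset.sum_eq_single a (fun b _ hb => hz b hb) (by simp)).symm.trans x.2)
        · exact hz a ha
      rw [hxi]; exact hi
    | succ N ih =>
      intro x hx
      by_cases hall : ∀ a, a ≠ i → x.1 a = 0
      · apply ih
        rw [Finset.sum_eq_zero]
        · omega
        · intro a _
          by_cases ha : a = i
          · simp [ha]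
          · simp [hall a ha]
      · push Not at hall
        obtain ⟨a, hai, hxa⟩ := hall
        have hxa' : 0 < x.1 a := by omega
        refine hP a (x, const 1 i) (replaceLetter x a (a - 1) hxa', const 1 i) ?_ (ih _ ?_)
        · rw [stepXI]
          left
          exact ⟨rfl, by rw [if_neg hai]; omega, hxa', replaceLetter_spec x a (a - 1) hxa'⟩
        · have h1 : ∑ b, (replaceLetter x a (a - 1) hxa').1 b * (b - i).val + (a - i).val =
              ∑ b, x.1 b * (b - i).val + (a - 1 - i).val := by
            have h2 := fun b => congrArg (· * (b - i).val)
              (replaceLetter_spec x a (a - 1) hxa' b)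
            have h3 := Finset.sum_congr rfl (fun b (_ : b ∈ Finset.univ) => h2 b)
            simpa [add_mul, Finset.sum_add_distrib] using h3
          have h4 : (a - 1 - i).val + 1 = (a - i).val := by
            have h5 : a - i ≠ 0 := sub_ne_zero.2 hai
            have h6 := val_pred (a - i)
            have h7 : (a - i).val ≠ 0 := fun h => h5 (Fin.ext h)
            rw [if_neg h7] at h6
            rw [sub_right_comm, h6]; omega
          omega
  have hB : ∀ i : Fin n, P (const l i, const 1 i) → ∀ x, P (x, const 1 i) :=
    fun i hi x => hA i hi _ x le_rfl
  have hC : ∀ i : Fin n, P (const l (i - 1), const 1 (i - 1)) → P (const l i, const 1 i) := by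
    intro i hi
    refine hP i _ (const l i, const 1 (i - 1)) ?_ (hB _ hi _)
    rw [stepXI]
    right
    exact ⟨by rw [const_apply, if_neg (pred_ne i)], rfl, rfl, rfl⟩
  have hD : ∀ m : ℕ, ∀ i : Fin n, i.val = m → P (const l i, const 1 i) := by
    have hz : P (const l 0, const 1 0) := by
      apply hC
      have : (0 - 1 : Fin n) = ⊤ := by
        apply Fin.ext
        rw [val_pred]
        have h2 : 2 ≤ n := Nat.AtLeastTwo.prop
        have hle : (⟨n - 1, by omega⟩ : Fin n) ≤ ⊤ := le_top
        rw [Fin.le_def] at hle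
        have := (⊤ : Fin n).2
        rw [if_pos (show (0 : Fin n).val = 0 from rfl)]
        simp only at hle
        omega
      rw [this]; exact h0
    intro m
    induction m with
    | zero =>
      intro i hi
      rw [show i = 0 from Fin.ext hi]; exact hz
    | succ m ih =>
      intro i hi
      apply hC
      apply ih
      rw [val_pred, if_neg (by omega)]; omega
  obtain ⟨x, b⟩ := p
  obtain ⟨i, rfl⟩ := letter_exists b
  exact hB i (hD _ i rfl) x

theorem iso_const {l : ℕ} {σ : B n l × B n 1 ≃ B n 1 × B n l} (h : IsCrystalIso σ)
    (t : Fin n) : σ (const l t, const 1 t) = (const 1 t, const l t) := by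
  have hE : ∀ k, k ≠ t → tensorE k (σ (const l t, const 1 t)) = none := by
    intro k hk
    rw [(h k _).1]
    have : tensorE k ((const l t, const 1 t) : B n l × B n 1) = none := by
      rw [tensorE_none]; simp [const_apply, hk]
    rw [this]; rfl
  have hF : ∀ k, k - 1 ≠ t → tensorF k (σ (const l t, const 1 t)) = none := by
    intro k hk
    rw [(h k _).2]
    have : tensorF k ((const l t, const 1 t) : B n l × B n 1) = none := by
      rw [tensorF_none]; simp [const_apply, hk]
    rw [this]; rfl
  generalize σ (const l t, const 1 t) = u at *
  obtain ⟨b, z⟩ := u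
  obtain ⟨j, rfl⟩ := letter_exists b
  simp only [tensorE_none, tensorF_none, const_apply] at hE hF
  have hj : j = t := by
    by_contra hne
    have := (hE j hne).1
    simp at this
  subst hj
  have hz : ∀ a, a ≠ j → z.1 a = 0 := by
    intro a ha
    have := (hF (a + 1) (by simpa using ha)).1
    simpa using this
  have : z = const l j := by
    refine B.ext fun a => ?_
    rw [const_apply]
    split_ifs with ha
    · subst ha
      exact ((Finset.sum_eq_single a (fun b _ hb => hz b hb) (by simp)).symm.trans z.2)
    · exact hz a ha
  rw [this]

theorem iso_unique {l : ℕ} {σ τ : B n l × B n 1 ≃ B n 1 × B n l} (hσ : IsCrystalIso σ)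
    (hτ : IsCrystalIso τ) : σ = τ := by
  refine Equiv.ext (connected (fun p => σ p = τ p) ?_ ?_)
  · rw [iso_const hσ, iso_const hτ]
  · intro k p q hpq hq
    have h1 := (hσ k q).2
    have h2 := (hτ k q).2
    rw [tensorF_iff_tensorE.2 hpq] at h1 h2
    rw [hq, h2] at h1
    simpa using h1.symm

theorem energy_unique {l : ℕ} {σ : B n l × B n 1 ≃ B n 1 × B n l}
    {H H' : B n l × B n 1 → ℤ} (h : IsEnergyFunction σ H) (h' : IsEnergyFunction σ H') :
    H = H' := by
  refine funext (connected (fun p => H p = H' p) (h.1.trans h'.1.symm) ?_)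
  intro k p q hpq hq
  have h1 := h.2 k p q hpq
  have h2 := h'.2 k p q hpq
  rw [hq, h2] at h1
  split_ifs at h1 <;> omega

/-- There is exactly one isomorphism `B_l ⊗ B_1 ≃ B_1 ⊗ B_l`. -/
theorem existsUnique_iso (n l : ℕ) [n.AtLeastTwo] :
    ∃! σ : B n l × B n 1 ≃ B n 1 × B n l, IsCrystalIso σ := by
  obtain ⟨σ, hσ⟩ := exists_equiv n l
  exact ⟨σ, isCrystalIso_of_rel σ hσ, fun τ hτ => iso_unique hτ (isCrystalIso_of_rel σ hσ)⟩

/-- The isomorphism `B_l ⊗ B_1 ≃ B_1 ⊗ B_l`, `b ⊗ b' ↦ b̃' ⊗ b̃`. -/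
noncomputable def iso (n l : ℕ) [n.AtLeastTwo] : B n l × B n 1 ≃ B n 1 × B n l :=
  Classical.choose (existsUnique_iso n l).exists

theorem iso_spec (n l : ℕ) [n.AtLeastTwo] : IsCrystalIso (iso n l) :=
  Classical.choose_spec (existsUnique_iso n l).exists

theorem iso_rel {l : ℕ} (p : B n l × B n 1) : RelPair p (iso n l p) := by
  obtain ⟨σ, hσ⟩ := exists_equiv n l
  rw [iso_unique (iso_spec n l) (isCrystalIso_of_rel σ hσ)]
  exact hσ p

/-- There is exactly one normalized energy function on `B_l ⊗ B_1`. -/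
theorem existsUnique_energy (n l : ℕ) [n.AtLeastTwo] :
    ∃! H : B n l × B n 1 → ℤ, IsEnergyFunction (iso n l) H := by
  classical
  choose i hi using fun p : B n l × B n 1 => letter_exists p.2
  choose j hj using fun q : B n 1 × B n l => letter_exists q.1
  have hrel : ∀ p : B n l × B n 1, Rel p.1 (i p) (j (iso n l p)) (iso n l p).2 := by
    intro p
    obtain ⟨i', j', h1, h2, h⟩ := iso_rel p
    rw [letter_unique ((hi p).symm.trans h1), letter_unique ((hj _).symm.trans h2)]
    exact h
  suffices h : IsEnergyFunction (iso n l)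
      (fun p : B n l × B n 1 => if j (iso n l p) < i p then -1 else 0) from
    ⟨_, h, fun H' hH' => energy_unique hH' h⟩
  refine ⟨?_, ?_⟩
  · have h1 : (⊤ : Fin n) = i (const l ⊤, const 1 ⊤) := letter_unique (hi (const l ⊤, const 1 ⊤))
    simp only
    rw [← h1, iso_const (iso_spec n l)]
    have h2 : (⊤ : Fin n) = j (const 1 ⊤, const l ⊤) := letter_unique (hj (const 1 ⊤, const l ⊤))
    rw [← h2, if_neg (lt_irrefl _)]
  · intro k p q hpq
    have hpe : p = (p.1, const 1 (i p)) := by rw [← hi]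
    have hqe : q = (q.1, const 1 (i q)) := by rw [← hi]
    have hpe' : iso n l p = (const 1 (j (iso n l p)), (iso n l p).2) := by rw [← hj]
    have hqe' : iso n l q = (const 1 (j (iso n l q)), (iso n l q).2) := by rw [← hj]
    have h' : tensorE k (iso n l p) = some (iso n l q) := by
      rw [((iso_spec n l) k p).1, hpq]; rfl
    have key := rel_energy (hrel p) k (x' := q.1) (i' := i q) (by rw [← hpe, ← hqe]; exact hpq)
      (z' := (iso n l q).2) (j' := j (iso n l q)) (by rw [← hpe', ← hqe']; exact h')
    simp only [phi_eq, eps_eq, ge_iff_le]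
    rw [hi p, hj (iso n l p)]
    exact key

/-- The energy function `H` on `B_l ⊗ B_1`, normalized by `H((n^l) ⊗ (n)) = 0`. -/
noncomputable def H (n l : ℕ) [n.AtLeastTwo] : B n l × B n 1 → ℤ :=
  Classical.choose (existsUnique_energy n l).exists

theorem H_spec (n l : ℕ) [n.AtLeastTwo] : IsEnergyFunction (iso n l) (H n l) :=
  Classical.choose_spec (existsUnique_energy n l).exists

end crystal

/-! ### The box ball system -/

/-- The states: elements `b_1 ⊗ b_2 ⊗ ⋯` with `b_j ∈ B_1` and `b_j = (n)` for all but finitely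
many `j`. This is the union of all `B_1^{⊗ L}` under the embeddings
`b_1 ⊗ ⋯ ⊗ b_L ↦ b_1 ⊗ ⋯ ⊗ b_L ⊗ (n) ⊗ ⋯ ⊗ (n)`. The factor `b_j` is `p.1 (j - 1)`. -/
abbrev State (n : ℕ) [n.AtLeastTwo] : Type :=
  {p : ℕ → B n 1 // ∃ L, ∀ j, L ≤ j → p j = const 1 ⊤}

section evolution

variable {n : ℕ} [n.AtLeastTwo]

/-- The elements `b^{(j)}` of `B_l`: one starts with `b^{(0)} = (n^l)` and moves the factor from
`B_l` through `b_1 ⊗ ⋯ ⊗ b_j` by the isomorphisms `B_l ⊗ B_1 ≃ B_1 ⊗ B_l`,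
`b^{(j - 1)} ⊗ b_j ↦ b̃_j ⊗ b^{(j)}`. -/
noncomputable def carrier (l : ℕ) (p : ℕ → B n 1) : ℕ → B n l
  | 0 => const l ⊤
  | j + 1 => (iso n l (carrier l p j, p j)).2

/-- The sequence `b̃_1, b̃_2, …`. -/
noncomputable def output (l : ℕ) (p : ℕ → B n 1) (j : ℕ) : B n 1 :=
  (iso n l (carrier l p j, p j)).1

theorem output_rel (l : ℕ) (p : ℕ → B n 1) (j : ℕ) :
    ∃ a b, p j = const 1 a ∧ output l p j = const 1 b ∧
      Rel (carrier l p j) a b (carrier l p (j + 1)) :=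
  iso_rel (carrier l p j, p j)

theorem eq_const_of_top {l : ℕ} {b : B n l} (h : l ≤ b.1 ⊤) : b = const l ⊤ := by
  have hs := b.2
  rw [← Finset.add_sum_erase _ _ (Finset.mem_univ ⊤)] at hs
  refine B.ext fun a => ?_
  rw [const_apply]
  split_ifs with ha
  · subst ha; omega
  · have := Finset.single_le_sum (f := b.1) (fun _ _ => Nat.zero_le _)
      (Finset.mem_erase.2 ⟨ha, Finset.mem_univ a⟩)
    omega

theorem top_val : (⊤ : Fin n).val = n - 1 := by
  have h2 : 2 ≤ n := Nat.AtLeastTwo.prop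
  have hle : (⟨n - 1, by omega⟩ : Fin n) ≤ ⊤ := le_top
  rw [Fin.le_def] at hle
  have := (⊤ : Fin n).2
  simp only at hle
  omega

/-- While letters `n` come in, each step adds a letter `n`, until `(n^l)` is reached. -/
theorem carrier_top {l : ℕ} {p : ℕ → B n 1} {L : ℕ} (hL : ∀ j, L ≤ j → p j = const 1 ⊤) (m : ℕ) :
    min m l ≤ (carrier l p (L + m)).1 ⊤ := by
  induction m with
  | zero => simp
  | succ m ih =>
    obtain ⟨a, b, h1, h2, h3⟩ := output_rel l p (L + m)
    rw [hL _ (by omega)] at h1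
    obtain rfl := letter_unique h1
    have h4 := h3.1 ⊤
    rw [if_pos rfl] at h4
    rw [← Nat.add_assoc]
    by_cases hb : ⊤ = b
    · subst hb
      rw [if_pos rfl] at h4
      have h5 : carrier l p (L + m) = const l ⊤ := by
        have hz : ∀ a, a ≠ ⊤ → (carrier l p (L + m)).1 a = 0 := by
          intro a ha
          apply h3.2
          have := ne_val ha
          have := a.2
          have := top_val (n := n)
          unfold Btw
          omega
        apply eq_const_of_top
        exact ((Finset.sum_eq_single ⊤ (fun b _ hb => hz b hb)
          (fun h => absurd (Finset.mem_univ _) h)).symm.trans (carrier l p (L + m)).2).ge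
      have h6 : (carrier l p (L + m)).1 ⊤ = l := by rw [h5, const_apply, if_pos rfl]
      omega
    · rw [if_neg hb] at h4
      omega

/-- For large `j`, `b^{(j)} = (n^l)`. -/
theorem carrier_eq {l : ℕ} {p : ℕ → B n 1} {L : ℕ} (hL : ∀ j, L ≤ j → p j = const 1 ⊤) {j : ℕ}
    (hj : L + l ≤ j) : carrier l p j = const l ⊤ := by
  obtain ⟨m, rfl⟩ := Nat.exists_eq_add_of_le (Nat.le_of_add_right_le hj)
  have := carrier_top hL (l := l) m
  apply eq_const_of_top
  rw [Nat.min_eq_right (by omega)] at this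
  exact this

/-- The time evolution `T_l`, which takes `b_1 ⊗ b_2 ⊗ ⋯` to `b̃_1 ⊗ b̃_2 ⊗ ⋯`. -/
noncomputable def T (l : ℕ) (p : State n) : State n :=
  ⟨output l p.1, by
    obtain ⟨p, L, hL⟩ := p
    refine ⟨L + l, fun j hj => ?_⟩
    change (iso n l (carrier l p j, p j)).1 = const 1 ⊤
    rw [carrier_eq hL hj, hL j (by omega), iso_const (iso_spec n l)]⟩

theorem rel_stable {l l' : ℕ} {x z : B n l} {x' z' : B n l'} {a b b' : Fin n}
    (h : Rel x a b z) (h' : Rel x' a b' z') (hx : 1 ≤ x.1 ⊤) (hx' : 1 ≤ x'.1 ⊤)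
    (he : ∀ c, c ≠ ⊤ → x.1 c = x'.1 c) : b = b' ∧ ∀ c, c ≠ ⊤ → z.1 c = z'.1 c := by
  have hb : b = b' := by
    by_contra hne
    have hv := ne_val hne
    have h1 := h.2 b'
    have h2 := h'.2 b
    have h3 := h.1 b
    have h4 := h'.1 b'
    have h5 : 0 < x.1 b ↔ 0 < x'.1 b := by
      by_cases hc : b = ⊤
      · rw [hc]; omega
      · rw [he b hc]
    have h6 : 0 < x.1 b' ↔ 0 < x'.1 b' := by
      by_cases hc : b' = ⊤
      · rw [hc]; omega
      · rw [he b' hc]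
    simp only [if_true] at h3 h4
    unfold Btw at h1 h2
    simp only [Fin.ext_iff] at h3 h4
    split_ifs at h3 h4 <;> omega
  subst hb
  refine ⟨rfl, fun c hc => ?_⟩
  have h1 := h.1 c
  have h2 := h'.1 c
  have h3 := he c hc
  omega

theorem carrier_lower {l : ℕ} {p : ℕ → B n 1} {L : ℕ} (hL : ∀ j, L ≤ j → p j = const 1 ⊤)
    (j : ℕ) : l ≤ (carrier l p j).1 ⊤ + min j L := by
  induction j with
  | zero => simp [carrier, const_apply]
  | succ j ih =>
    obtain ⟨a, b, h1, h2, h3⟩ := output_rel l p j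
    have h4 := h3.1 ⊤
    by_cases hj : L ≤ j
    · rw [hL _ hj] at h1
      rw [if_pos (letter_unique h1)] at h4
      split_ifs at h4 <;> omega
    · split_ifs at h4 <;> omega

theorem carrier_stable {p : ℕ → B n 1} {L : ℕ} (hL : ∀ j, L ≤ j → p j = const 1 ⊤) {l l' : ℕ}
    (hl : L < l) (hl' : L < l') (j : ℕ) :
    ∀ c, c ≠ ⊤ → (carrier l p j).1 c = (carrier l' p j).1 c := by
  induction j with
  | zero => intro c hc; simp [carrier, const_apply, hc]
  | succ j ih =>
    obtain ⟨a, b, h1, h2, h3⟩ := output_rel l p j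
    obtain ⟨a', b', h1', h2', h3'⟩ := output_rel l' p j
    obtain rfl := letter_unique (h1.symm.trans h1')
    have h4 := carrier_lower hL (l := l) j
    have h5 := carrier_lower hL (l := l') j
    exact (rel_stable h3 h3' (by omega) (by omega) ih).2

/-- For a fixed state the `T_l` with large `l` agree. -/
theorem T_stable (p : State n) : ∃ q, ∃ l₀, ∀ l, l₀ ≤ l → T l p = q := by
  obtain ⟨p, L, hL⟩ := p
  refine ⟨T (L + 1) ⟨p, L, hL⟩, L + 1, fun l hl => Subtype.ext (funext fun j => ?_)⟩
  change output l p j = output (L + 1) p j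
  obtain ⟨a, b, h1, h2, h3⟩ := output_rel l p j
  obtain ⟨a', b', h1', h2', h3'⟩ := output_rel (L + 1) p j
  obtain rfl := letter_unique (h1.symm.trans h1')
  have h4 := carrier_lower hL (l := l) j
  have h5 := carrier_lower hL (l := L + 1) j
  rw [h2, h2', (rel_stable h3 h3' (by omega) (by omega)
    (carrier_stable hL (by omega) (by omega) j)).1]

/-- The time evolution `T = lim_{l → ∞} T_l`, where `T(p)` is the common value of `T_l(p)` for all
sufficiently large `l`. -/
noncomputable def TLim (p : State n) : State n := Classical.choose (T_stable p)

theorem TLim_spec (p : State n) : ∃ l₀, ∀ l, l₀ ≤ l → T l p = TLim p :=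
  Classical.choose_spec (T_stable p)

/-- `H_j = H(b^{(j - 1)} ⊗ b_j)`, with the index `j - 1` in place of `j`. -/
noncomputable def localH (l : ℕ) (p : State n) (j : ℕ) : ℤ := H n l (carrier l p.1 j, p.1 j)

/-- Only finitely many `H_j` are not zero. -/
theorem localH_finite (l : ℕ) (p : State n) : (Function.support (localH l p)).Finite := by
  obtain ⟨p, L, hL⟩ := p
  refine (Set.finite_lt_nat (L + l)).subset fun j hj => ?_
  by_contra hcon
  simp only [Set.mem_ofPred_eq, not_lt] at hcon
  refine hj ?_
  unfold localH
  simp only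
  rw [carrier_eq hL hcon, hL j (by omega)]
  exact (H_spec n l).1

/-- `E_l(p) = - ∑_j H_j`, a sum with finitely many nonzero terms. -/
noncomputable def E (l : ℕ) (p : State n) : ℤ := -∑ᶠ j, localH l p j

end evolution

end BoxBall

namespace BoxBall

variable {n : ℕ} [n.AtLeastTwo]

/-! ### Queues on a cycle -/

/-! The theorem is a Yang–Baxter argument. To compare `T l (T l' p)` with `T l' (T l p)` for `l' ≤
l`, two carriers run past the same letters, and their contents at corresponding positions should be
related by the combinatorial R for `B n l` and `B n l'`. This relation is expressed by a queue on
the cycle of letters: the larger carrier supplies services, the smaller one supplies customers, and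
`q` records how many customers reach each site. Passing a single letter is the case of one customer,
whose queue is the indicator `path`.

For queues, Yang–Baxter holds site by site as a piecewise linear identity (`IsQueue.interchange`).
The three queue lengths transform by the tropical map `s = min q s'`, `s + q₁ = q + r'`, `r + s = r'
+ s'`. Hence the relation between the carriers survives every letter and the emitted letters
coincide (`IsQueue.interchange_rel`, `carriers_interchange`).

Energy is read off from the same identities at the site `⊤`: by `H_eq`, `H` is the number of
customers at `⊤` minus one. So `q + r' = s + q₁` says that the change of `q ⊤` balances the local
energies of `p` and `T l' p`. Both carriers are constant words at the start and far to the right,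
where `q ⊤ = l'` in each case; thus the total energy for `l` is unchanged. The identity `r + s = r'
+ s'` then transfers the result to the energy for `l'`. -/

/-- Queues move from `a` to `a - 1`, so properties of them are propagated once around the cycle in
this direction. -/
theorem cyclic_induction {P : Fin n → Prop} {a₀ : Fin n} (h₀ : P a₀)
    (h : ∀ a, P a → P (a - 1)) (a : Fin n) : P a := by
  have key : ∀ (m : ℕ) (a : Fin n), (a₀ - a).val = m → P a := by
    intro m
    induction m with
    | zero =>
      intro a ha
      have : a₀ - a = 0 := Fin.ext (ha.trans rfl)
      rwa [← sub_eq_zero.1 this]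
    | succ m ih =>
      intro a ha
      have h1 : (a₀ - (a + 1)).val = m := by
        rw [sub_add_eq_sub_sub, val_pred, if_neg (by omega)]
        omega
      simpa using h _ (ih _ h1)
  exact key _ a rfl

/-- A queue on the cycle of sites `a, a - 1, a - 2, …`: the queue `q a` that reaches the site `a`
is served at most `x a` times, then `y a` customers join it. The services used are `y'`, and
`x'` counts the arrivals together with the services that were not used. This is the rule
`x ⊗ y ↦ y' ⊗ x'` of the combinatorial `R` on row tableaux. -/
structure IsQueue (x y q y' x' : Fin n → ℕ) : Prop where
  next : ∀ a, q (a - 1) = (q a - x a) + y a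
  served : ∀ a, y' a = min (q a) (x a)
  unserved : ∀ a, x' a = y a + (x a - q a)

/-- The tetrahedron equation: queues can be interchanged. -/
theorem IsQueue.interchange {x y q y' x' v r' w x₁' s' u y₁' : Fin n → ℕ}
    (hq : IsQueue x y q y' x') (hr : IsQueue x' v r' w x₁') (hs : IsQueue y' w s' u y₁') :
    ∃ t y₁ x₁ : Fin n → ℕ,
      IsQueue y v (fun a => r' a + s' a - min (q a) (s' a)) t y₁ ∧
      IsQueue x t (fun a => min (q a) (s' a)) u x₁ ∧
      IsQueue x₁ y₁ (fun a => q a + r' a - min (q a) (s' a)) y₁' x₁' := by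
  -- The outputs are forced by the rules for served and unserved, once the three queue lengths are
  -- given by the tropical map.
  refine ⟨fun a => min (r' a + s' a - min (q a) (s' a)) (y a),
    fun a => v a + (y a - (r' a + s' a - min (q a) (s' a))),
    fun a => min (r' a + s' a - min (q a) (s' a)) (y a) + (x a - min (q a) (s' a)),
    ⟨fun a => ?_, fun a => rfl, fun a => rfl⟩, ⟨fun a => ?_, fun a => ?_, fun a => rfl⟩,
    ⟨fun a => ?_, fun a => ?_, fun a => ?_⟩⟩
  -- Every remaining equation involves only the values of `q`, `r'`, `s'`, `x`, `y`, `v` at one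
  -- site, so no global information about the cycle is needed.
  all_goals
    simp only [hq.next, hr.next, hs.next, hs.served, hs.unserved, hr.served, hr.unserved,
      hq.served, hq.unserved]
    omega

/-- A cycle has no starting site, so `x` and `y` alone need not determine the queue: if services are
exhausted everywhere, extra customers can circulate forever. One common value excludes this. -/
theorem IsQueue.congr {x y q y' x' r z' w' : Fin n → ℕ} (hq : IsQueue x y q y' x')
    (hr : IsQueue x y r z' w') {a : Fin n} (h : q a = r a) : q = r ∧ y' = z' ∧ x' = w' := by
  have h1 : ∀ b, q b = r b := cyclic_induction (P := fun b => q b = r b) h fun b hb => by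
    rw [hq.next, hr.next, hb]
  refine ⟨funext h1, funext fun b => ?_, funext fun b => ?_⟩
  · rw [hq.served, hr.served, h1]
  · rw [hq.unserved, hr.unserved, h1]

/-! ### One-customer queues and the explicit rule for a single letter -/

/-- The content of a single letter. -/
def letter (i a : Fin n) : ℕ := if a = i then 1 else 0

theorem letter_self (i : Fin n) : letter i i = 1 := if_pos rfl

theorem letter_injective {i j : Fin n} (h : letter i = letter j) : i = j := by
  have := congrFun h i
  unfold letter at this
  by_contra hne
  simp [hne] at this

open Classical in
/-- The indicator of the sites passed on the way from `i - 1` down to `j`. -/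
noncomputable def path (j i a : Fin n) : ℕ := if a = j ∨ Btw j a i then 1 else 0

theorem path_le_one (j i a : Fin n) : path j i a ≤ 1 := by
  unfold path; split_ifs <;> omega

theorem eq_of_path_self {j i : Fin n} (h : 0 < path j i i) : i = j := by
  unfold path Btw at h
  split_ifs at h <;> omega

/-- The descent from `i - 1` to `j` meets `⊤` exactly when it wraps around; this is what turns
winding into a queue length. -/
theorem path_top (j i : Fin n) : path j i ⊤ = if j < i then 0 else 1 := by
  have h1 := top_val (n := n)
  have h2 := i.2
  have h3 := j.2
  unfold path Btw
  simp only [Fin.ext_iff, Fin.lt_def]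
  split_ifs <;> omega

/-- If `j = i`, every other letter is strictly between, so `x` is the constant word in `j`;
otherwise the contents decide. -/
theorem Rel.pos {l : ℕ} {x z : B n l} {i j : Fin n} (hl : 0 < l) (h : Rel x i j z) :
    0 < x.1 j := by
  by_cases hji : j = i
  · subst hji
    have hz : ∀ a, a ≠ j → x.1 a = 0 := fun a ha => h.2 a (by
      have := ne_val ha
      unfold Btw
      omega)
    have := (Finset.sum_eq_single j (fun b _ hb => hz b hb) (by simp)).symm.trans x.2
    omega
  · have := h.1 j
    simp [hji] at this
    omega

/-- The single customer joins at `i` and takes the first service met on the way down, which is at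
`j` because `x` has no letter strictly between. -/
theorem Rel.isQueue {l : ℕ} {x z : B n l} {i j : Fin n} (hl : 0 < l) (h : Rel x i j z) :
    IsQueue x.1 (letter i) (path j i) (letter j) z.1 := by
  have hj := h.pos hl
  refine ⟨fun a => ?_, fun a => ?_, fun a => ?_⟩
  · have h1 := h.2 a
    have h2 := val_pred a
    have h3 := a.2
    have h4 := i.2
    have h5 := j.2
    unfold path letter
    by_cases haj : a = j
    · subst haj
      unfold Btw
      simp only [Fin.ext_iff]
      split_ifs at h2 ⊢ <;> omega
    · have h6 := ne_val haj
      unfold Btw at h1 ⊢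
      simp only [Fin.ext_iff]
      split_ifs at h2 ⊢ <;> omega
  · have h1 : a ≠ j → a = j ∨ Btw j a i → x.1 a = 0 := fun h1 h2 => h.2 a (h2.resolve_left h1)
    unfold path letter
    by_cases haj : a = j
    · subst haj
      simp
      omega
    · rw [if_neg haj]
      split_ifs with hb
      · rw [h1 haj hb]; simp
      · simp
  · have h1 : a ≠ j → a = j ∨ Btw j a i → x.1 a = 0 := fun h1 h2 => h.2 a (h2.resolve_left h1)
    have h2 := h.1 a
    unfold path letter
    by_cases haj : a = j
    · subst haj
      simp at h2 ⊢
      omega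
    · rw [if_neg haj] at h2
      by_cases hb : a = j ∨ Btw j a i
      · have := h1 haj hb
        rw [if_pos hb]
        omega
      · rw [if_neg hb]
        omega

/-- For a single letter, a queue of length at most one gives the explicit rule. -/
theorem IsQueue.rel {l : ℕ} {x : B n l} {i : Fin n} {r t z : Fin n → ℕ} (hl : 0 < l)
    (h : IsQueue x.1 (letter i) r t z) (hr : ∀ a, r a ≤ 1) {j : Fin n} {x₁ : B n l}
    (hx : Rel x i j x₁) : r = path j i ∧ t = letter j ∧ z = x₁.1 := by
  -- The customer has just joined at `i`, so both queues are at least one at `i - 1`; the bound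
  -- makes them equal there.
  refine h.congr (hx.isQueue hl) (a := i - 1) ?_
  have h1 := h.next i
  have h2 := (hx.isQueue hl).next i
  rw [letter_self] at h1 h2
  have h3 := hr (i - 1)
  have h4 := path_le_one j i (i - 1)
  omega

theorem exists_pos {l : ℕ} (hl : 0 < l) (x : B n l) : ∃ a, x.1 a ≠ 0 := by
  by_contra! h
  have := x.2
  simp [h] at this
  omega

/-! ### Two carriers passing one letter -/

/-- Apply `IsQueue.interchange` and identify the new one-letter queues by `IsQueue.rel`. Two points
are global: the new queue for `y` has length at most one, and the new `q₁` does not exceed the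
services at some site. A failure of either would spread around the cycle and force `x'` to vanish,
against `0 < l`. -/
theorem IsQueue.interchange_rel {l l' : ℕ} (hl : 0 < l) (hl' : 0 < l') {x x₁ x' x₁' : B n l}
    {y y₁ y' y₁' : B n l'} {q : Fin n → ℕ} {i j k j' k' : Fin n}
    (hq : IsQueue x.1 y.1 q y'.1 x'.1) (hn : ∃ a, q a ≤ x.1 a)
    (h1 : Rel y i j y₁) (h2 : Rel x j k x₁) (h3 : Rel x' i j' x₁') (h4 : Rel y' j' k' y₁') :
    k = k' ∧ ∃ q₁, IsQueue x₁.1 y₁.1 q₁ y₁'.1 x₁'.1 ∧ (∃ a, q₁ a ≤ x₁.1 a) ∧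
      (∀ a, q a + path j' i a = path k j a + q₁ a) ∧
      ∀ a, path j i a + path k j a = path j' i a + path k' j' a := by
  have hr := h3.isQueue hl
  have hs := h4.isQueue hl'
  obtain ⟨t, y₂, x₂, e1, e2, e3⟩ := hq.interchange hr hs
  obtain ⟨c, hc⟩ := exists_pos hl x'
  have hr1 : ∀ a, path j' i a + path k' j' a - min (q a) (path k' j' a) ≤ 1 := by
    by_contra! hcon
    obtain ⟨a₀, ha₀⟩ := hcon
    -- A length above one means exactly this triple of values. If `x'` were nonzero at `a`, the
    -- letter would be served there, so `a = j'`; the second path then meets its own start, which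
    -- forces `k' = j'` and a service of `y'` at `a`. But `q a = 0` leaves `y'` empty at `a`.
    have hdesc : ∀ a, (path j' i a = 1 ∧ path k' j' a = 1 ∧ q a = 0) → x'.1 a = 0 := by
      rintro a ⟨b1, b2, b3⟩
      by_contra hx
      have b4 := hr.served a
      unfold letter at b4
      split_ifs at b4 with haj
      · subst haj
        have b5 := eq_of_path_self (by omega : 0 < path k' a a)
        subst b5
        have b6 := hs.served a
        rw [letter_self] at b6
        have b7 := hq.served a
        omega
      · omega
    refine hc (hdesc c (cyclic_induction
      (P := fun a => path j' i a = 1 ∧ path k' j' a = 1 ∧ q a = 0) (a₀ := a₀) ?_ ?_ c))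
    · have := path_le_one j' i a₀
      have := path_le_one k' j' a₀
      omega
    · rintro a ⟨b1, b2, b3⟩
      have b0 := hdesc a ⟨b1, b2, b3⟩
      have b4 := hq.unserved a
      have b5 := hq.next a
      have b6 := hr.next a
      have b7 := hs.next a
      have b8 := hq.served a
      have := path_le_one j' i (a - 1)
      have := path_le_one k' j' (a - 1)
      omega
  obtain ⟨f1, rfl, f3⟩ := e1.rel hl' hr1 h1
  obtain ⟨g1, g2, g3⟩ := e2.rel hl (fun a => (min_le_right _ _).trans (path_le_one _ _ _)) h2
  obtain rfl := letter_injective g2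
  subst f3 g3
  refine ⟨rfl, _, e3, ?_, fun a => ?_, fun a => ?_⟩
  · by_contra! hcon
    obtain ⟨a₀, ha₀⟩ := hn
    -- With `path j' i a = 1`, the assumption that `q₁` exceeds `x₁` leaves no room for an unused
    -- service or for an arrival; hence the queue is empty at the next site and the condition
    -- persists.
    have hdesc : ∀ a, (q a ≤ x.1 a ∧ path j' i a = 1) → y.1 a = 0 ∧ q a = x.1 a := by
      rintro a ⟨b1, b2⟩
      have b3 := hcon a
      rw [e2.unserved, e1.served] at b3
      omega
    have hz : ∀ a, (q a ≤ x.1 a ∧ path j' i a = 1) → x'.1 a = 0 := by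
      intro a ha
      have := hdesc a ha
      rw [hq.unserved]
      omega
    refine hc (hz c (cyclic_induction (P := fun a => q a ≤ x.1 a ∧ path j' i a = 1)
      (a₀ := a₀) ?_ ?_ c))
    · refine ⟨ha₀, ?_⟩
      have b1 := hcon a₀
      rw [e2.unserved] at b1
      have := path_le_one j' i a₀
      omega
    · rintro a ha
      have b0 := hdesc a ha
      have b1 := hz a ha
      have b5 := hq.next a
      have b6 := hr.next a
      have := path_le_one j' i (a - 1)
      omega
  · have := congrFun g1 a
    omega
  · have e1 := congrFun f1 a
    have e2 := congrFun g1 a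
    omega

/-! ### The energy function in terms of paths -/

/-- The function equal to `-1` on winding-free descents (`j < i`) and `0` otherwise satisfies the
energy recursion by `rel_energy`, and the energy function is unique. -/
theorem H_eq {l : ℕ} {x z : B n l} {i j : Fin n} (h : Rel x i j z) :
    H n l (x, const 1 i) = (path j i ⊤ : ℤ) - 1 := by
  classical
  choose i₀ hi using fun p : B n l × B n 1 => letter_exists p.2
  choose j₀ hj using fun q : B n 1 × B n l => letter_exists q.1
  have hrel : ∀ p : B n l × B n 1, Rel p.1 (i₀ p) (j₀ (iso n l p)) (iso n l p).2 := by
    intro p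
    obtain ⟨i', j', h1, h2, h⟩ := iso_rel p
    rw [letter_unique ((hi p).symm.trans h1), letter_unique ((hj _).symm.trans h2)]
    exact h
  have hE : IsEnergyFunction (iso n l)
      (fun p : B n l × B n 1 => if j₀ (iso n l p) < i₀ p then -1 else 0) := by
    refine ⟨?_, fun k p q hpq => ?_⟩
    · have h1 : (⊤ : Fin n) = i₀ (const l ⊤, const 1 ⊤) := letter_unique (hi (const l ⊤, const 1 ⊤))
      simp only
      rw [← h1, iso_const (iso_spec n l)]
      have h2 : (⊤ : Fin n) = j₀ (const 1 ⊤, const l ⊤) := letter_unique (hj (const 1 ⊤, const l ⊤))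
      rw [← h2, if_neg (lt_irrefl _)]
    · have hpe : p = (p.1, const 1 (i₀ p)) := by rw [← hi]
      have hqe : q = (q.1, const 1 (i₀ q)) := by rw [← hi]
      have hpe' : iso n l p = (const 1 (j₀ (iso n l p)), (iso n l p).2) := by rw [← hj]
      have hqe' : iso n l q = (const 1 (j₀ (iso n l q)), (iso n l q).2) := by rw [← hj]
      have h' : tensorE k (iso n l p) = some (iso n l q) := by
        rw [((iso_spec n l) k p).1, hpq]; rfl
      have key := rel_energy (hrel p) k (x' := q.1) (i' := i₀ q) (by rw [← hpe, ← hqe]; exact hpq)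
        (z' := (iso n l q).2) (j' := j₀ (iso n l q)) (by rw [← hpe', ← hqe']; exact h')
      simp only [phi_eq, eps_eq, ge_iff_le]
      rw [hi p, hj (iso n l p)]
      exact key
  rw [energy_unique (H_spec n l) hE, path_top]
  have h1 : i₀ (x, const 1 i) = i := (letter_unique (hi (x, const 1 i))).symm
  have h2 := hrel (x, const 1 i)
  rw [h1] at h2
  simp only
  rw [h1, (rel_unique h2 h).1]
  split_ifs <;> simp

/-! ### Two carriers -/

theorem localH_eq {l : ℕ} {p : State n} {j : ℕ} {a b : Fin n} (hp : p.1 j = const 1 a)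
    (h : Rel (carrier l p.1 j) a b (carrier l p.1 (j + 1))) :
    localH l p j = (path b a ⊤ : ℤ) - 1 := by
  unfold localH
  rw [hp]
  exact H_eq h

/-- All `l'` customers join at `⊤`, make one full turn and are served at `⊤`, where `l ≥ l'`
services suffice. -/
theorem isQueue_const {l l' : ℕ} (h : l' ≤ l) :
    IsQueue (const l ⊤ : B n l).1 (const l' ⊤ : B n l').1 (fun _ => l')
      (const l' ⊤ : B n l').1 (const l ⊤ : B n l).1 := by
  refine ⟨fun a => ?_, fun a => ?_, fun a => ?_⟩ <;> simp only [const_apply] <;>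
    split_ifs <;> omega

/-- Nothing happens away from `⊤`, so `q` is constant. The bound `hn` excludes customers that
circulate without being served, which could otherwise occur for `l = l'`. -/
theorem IsQueue.top_of_const {l l' : ℕ} {q y' x' : Fin n → ℕ} (hl' : 0 < l')
    (hq : IsQueue (const l ⊤ : B n l).1 (const l' ⊤ : B n l').1 q y' x')
    (hn : ∃ a, q a ≤ (const l ⊤ : B n l).1 a) : q ⊤ = l' := by
  have hc : ∀ a, q a = q (⊤ - 1) :=
    cyclic_induction (P := fun a => q a = q (⊤ - 1)) (a₀ := ⊤ - 1) rfl fun a ha => by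
      by_cases h : a = ⊤
      · rw [h]
      · have := hq.next a
        simp only [const_apply, h, if_false] at this
        omega
  obtain ⟨a, ha⟩ := hn
  have h1 := hq.next ⊤
  have h2 := hc a
  have h3 := hc ⊤
  simp only [const_apply, if_true] at h1 ha
  split_ifs at ha <;> omega

/-- This is the invariant of the whole evolution. The existential bound on `q` is carried along
because the final value of `q ⊤` depends on it; the two energy identities are the sums over
positions of those in `IsQueue.interchange_rel` at `⊤`. -/
theorem carriers_interchange {l l' : ℕ} (hl' : 0 < l') (h : l' ≤ l) (p : State n) (N : ℕ) :
    ∃ q, IsQueue (carrier l (T l' p).1 N).1 (carrier l' p.1 N).1 q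
        (carrier l' (T l p).1 N).1 (carrier l p.1 N).1 ∧
      (∃ a, q a ≤ (carrier l (T l' p).1 N).1 a) ∧
      (∀ j < N, (T l (T l' p)).1 j = (T l' (T l p)).1 j) ∧
      (q ⊤ : ℤ) + ∑ j ∈ Finset.range N, localH l (T l' p) j =
        l' + ∑ j ∈ Finset.range N, localH l p j ∧
      ∑ j ∈ Finset.range N, localH l' p j + ∑ j ∈ Finset.range N, localH l (T l' p) j =
        ∑ j ∈ Finset.range N, localH l p j + ∑ j ∈ Finset.range N, localH l' (T l p) j := by
  induction N with
  | zero =>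
    refine ⟨_, isQueue_const h, ⟨⊤, ?_⟩, by simp, by simp, by simp⟩
    change l' ≤ (const l ⊤ : B n l).1 ⊤
    rw [const_apply, if_pos rfl]
    exact h
  | succ N ih =>
    obtain ⟨q, hq, hn, hT, hE, hE'⟩ := ih
    obtain ⟨i, j, a1, a2, a3⟩ := output_rel l' p.1 N
    obtain ⟨j₀, k, b1, b2, b3⟩ := output_rel l (T l' p).1 N
    obtain ⟨i₀, j', c1, c2, c3⟩ := output_rel l p.1 N
    obtain ⟨j₀', k', d1, d2, d3⟩ := output_rel l' (T l p).1 N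
    -- The letter emitted by the first carrier is the one received by the second, in either order of
    -- the carriers.
    obtain rfl : j = j₀ := letter_unique (a2.symm.trans b1)
    obtain rfl : i = i₀ := letter_unique (a1.symm.trans c1)
    obtain rfl : j' = j₀' := letter_unique (c2.symm.trans d1)
    obtain ⟨rfl, q₁, f1, f2, f3, f4⟩ := hq.interchange_rel (hl'.trans_le h) hl' hn a3 b3 c3 d3
    have g1 := localH_eq a1 a3
    have g2 := localH_eq b1 b3
    have g3 := localH_eq c1 c3
    have g4 := localH_eq d1 d3
    have f3 := f3 ⊤
    have f4 := f4 ⊤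
    refine ⟨q₁, f1, f2, fun t ht => ?_, ?_, ?_⟩
    · rcases Nat.lt_succ_iff_lt_or_eq.1 ht with ht | rfl
      · exact hT t ht
      · exact b2.trans d2.symm
    · simp only [Finset.sum_range_succ]
      omega
    · simp only [Finset.sum_range_succ]
      omega

/-! ### Commutation and conservation for ordered capacities -/

theorem T_comm_of_le {l l' : ℕ} (hl' : 0 < l') (h : l' ≤ l) (p : State n) :
    T l (T l' p) = T l' (T l p) := by
  refine Subtype.ext (funext fun j => ?_)
  obtain ⟨q, -, -, hT, -⟩ := carriers_interchange hl' h p (j + 1)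
  exact hT j (Nat.lt_succ_self j)

theorem exists_carrier_eq (l : ℕ) (p : State n) :
    ∃ N, ∀ j, N ≤ j → carrier l p.1 j = const l ⊤ := by
  obtain ⟨p, L, hL⟩ := p
  exact ⟨L + l, fun j hj => carrier_eq hL hj⟩

theorem exists_sum_eq (l : ℕ) (p : State n) :
    ∃ N, ∀ M, N ≤ M → ∑ j ∈ Finset.range M, localH l p j = -E l p := by
  obtain ⟨N, hN⟩ := (localH_finite l p).bddAbove
  refine ⟨N + 1, fun M hM => ?_⟩
  rw [E, neg_neg]
  refine (finsum_eq_sum_of_support_subset _ fun j hj => ?_).symm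
  have := hN hj
  simp only [Finset.coe_range, Set.mem_Iio]
  omega

/-- Far to the right the queue is again between constant words, so `q ⊤` returns to `l'` and cancels
in the first energy identity; the second then settles the energy of the smaller carrier. -/
theorem E_T_of_le {l l' : ℕ} (hl' : 0 < l') (h : l' ≤ l) (p : State n) :
    E l (T l' p) = E l p ∧ E l' (T l p) = E l' p := by
  obtain ⟨N1, h1⟩ := exists_sum_eq l (T l' p)
  obtain ⟨N2, h2⟩ := exists_sum_eq l p
  obtain ⟨N3, h3⟩ := exists_sum_eq l' (T l p)
  obtain ⟨N4, h4⟩ := exists_sum_eq l' p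
  obtain ⟨N5, h5⟩ := exists_carrier_eq l (T l' p)
  obtain ⟨N6, h6⟩ := exists_carrier_eq l' p
  obtain ⟨q, hq, hn, -, e1, e2⟩ :=
    carriers_interchange hl' h p (N1 + N2 + N3 + N4 + N5 + N6)
  rw [h5 _ (by omega), h6 _ (by omega)] at hq
  rw [h5 _ (by omega)] at hn
  have h7 := hq.top_of_const hl' hn
  rw [h1 _ (by omega), h2 _ (by omega)] at e1 e2
  rw [h3 _ (by omega), h4 _ (by omega)] at e2
  omega

end BoxBall

theorem theorem3p2 (n : ℕ) [n.AtLeastTwo] (p : BoxBall.State n) :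
    (∀ l l' : ℕ, 0 < l → 0 < l' →
      BoxBall.T l (BoxBall.T l' p) = BoxBall.T l' (BoxBall.T l p)) ∧
    (∀ l l' : ℕ, 0 < l → 0 < l' →
      BoxBall.E l (BoxBall.T l' p) = BoxBall.E l p) ∧
    (∀ l : ℕ, 0 < l → BoxBall.E l (BoxBall.TLim p) = BoxBall.E l p) := by
  have hE : ∀ l l' : ℕ, 0 < l → 0 < l' →
      BoxBall.E l (BoxBall.T l' p) = BoxBall.E l p := fun l l' hl hl' =>
    (le_total l' l).elim (fun h => (BoxBall.E_T_of_le hl' h p).1)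
      fun h => (BoxBall.E_T_of_le hl h p).2
  refine ⟨fun l l' hl hl' => ?_, hE, fun l hl => ?_⟩
  · exact (le_total l' l).elim (fun h => BoxBall.T_comm_of_le hl' h p)
      fun h => (BoxBall.T_comm_of_le hl h p).symm
  · obtain ⟨l₀, h⟩ := BoxBall.TLim_spec p
    -- The limit is attained at a finite capacity; `l₀ + 1` is used because it is positive.
    rw [← h (l₀ + 1) (by omega)]
    exact hE l (l₀ + 1) hl (by omega)
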